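/- Let $K$ be a field of characteristic $0$ and let $E$ be a Hopf algebra over $K$ that is connected, i.e. whose coradical (the sum of all simple subcoalgebras of $E$) is one-dimensional over $K$. Assume that $E\neq K$, i.e. that the unit map $K\to E$ is not surjective. Let $P(E)=\{x\in E:\Delta(x)=x\otimes 1+1\otimes x\}$ be the space of primitive elements of $E$. For $x\in P(E)$ let $K[x]$ be the subalgebra of $E$ generated by $x$ (it is a Hopf subalgebra of $E$), and let $xE=\{xe: e\in E\}$. A weak projection of $E$ onto a Hopf subalgebra $H\subseteq E$ is a coalgebra map $\pi:E\to H$ that is left $H$-linear, i.e. $\pi(he)=h\,\pi(e)$ for all $h\in H$, $e\in E$, and satisfies $\pi(h)=h$ for all $h\in H$. Then for every $x\in P(E)\setminus\{0\}$ there exists a weak projection $\pi:E\to K[x]$. In particular, there is a $K$-linear isomorphism $$E\;\simeq\; K[x]\otimes_K \frac{E}{xE}.$$ -/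

import Mathlib

open scoped TensorProduct

namespace ConnectedHopf

universe u v

section Coalgebras

variable (K : Type u) [Field K] {C : Type v} [AddCommGroup C] [Module K C] [Coalgebra K C]

/-- A subspace `V` of a coalgebra `C` is a subcoalgebra if `Δ(V) ⊆ V ⊗ V`, where `V ⊗ V` is
regarded as a subspace of `C ⊗ C`. -/
def IsSubcoalgebra (V : Submodule K C) : Prop :=
  ∀ c ∈ V, Coalgebra.comul (R := K) c ∈ LinearMap.range (TensorProduct.map V.subtype V.subtype)

/-- A simple subcoalgebra: a nonzero subcoalgebra whose only subcoalgebras are `0` and itself. -/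
def IsSimpleSubcoalgebra (V : Submodule K C) : Prop :=
  IsSubcoalgebra K V ∧ V ≠ ⊥ ∧ ∀ W : Submodule K C, IsSubcoalgebra K W → W ≤ V → W = ⊥ ∨ W = V

variable (C) in
/-- The coradical of a coalgebra: the sum of all its simple subcoalgebras. -/
def coradical : Submodule K C :=
  sSup {V : Submodule K C | IsSimpleSubcoalgebra K V}

variable (C) in
/-- A coalgebra is connected if its coradical is one-dimensional. -/
def IsConnected : Prop :=
  Module.finrank K (coradical K C) = 1

end Coalgebras

section HopfAlgebras

variable (K : Type u) [Field K] (E : Type v) [Ring E] [HopfAlgebra K E]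

/-- The space `P(E)` of primitive elements: those `x` with `Δ(x) = x ⊗ 1 + 1 ⊗ x`. -/
def primitives : Submodule K E where
  carrier := {x | Coalgebra.comul (R := K) x = x ⊗ₜ[K] (1 : E) + (1 : E) ⊗ₜ[K] x}
  add_mem' := by
    intro a b ha hb
    simp only [Set.mem_ofPred_eq] at ha hb ⊢
    rw [map_add, ha, hb, TensorProduct.add_tmul, TensorProduct.tmul_add]
    abel
  zero_mem' := by simp
  smul_mem' := by
    intro c a ha
    simp only [Set.mem_ofPred_eq] at ha ⊢
    rw [map_smul, ha, smul_add, TensorProduct.smul_tmul', TensorProduct.tmul_smul]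

/-- A Hopf subalgebra: a subalgebra that is a subcoalgebra and is stable under the antipode. -/
structure HopfSubalgebra extends Subalgebra K E where
  isSubcoalgebra : IsSubcoalgebra K (Subalgebra.toSubmodule toSubalgebra)
  antipode_mem : ∀ a ∈ toSubalgebra, HopfAlgebra.antipode K a ∈ toSubalgebra

end HopfAlgebras

namespace HopfSubalgebra

variable {K : Type u} [Field K] {E : Type v} [Ring E] [HopfAlgebra K E] (H : HopfSubalgebra K E)

/-- The inclusion of a Hopf subalgebra, as a linear map. -/
abbrev incl : H.toSubalgebra →ₗ[K] E := H.toSubalgebra.val.toLinearMap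

theorem incl_injective : Function.Injective H.incl := Subtype.val_injective

theorem map_incl_injective : Function.Injective (TensorProduct.map H.incl H.incl) :=
  TensorProduct.map_injective_of_flat_flat _ _ H.incl_injective H.incl_injective

theorem exists_comul (a : H.toSubalgebra) :
    Coalgebra.comul (R := K) (a : E) ∈ LinearMap.range (TensorProduct.map H.incl H.incl) :=
  H.isSubcoalgebra a a.2

/-- The comultiplication of a Hopf subalgebra: the restriction of that of `E`. -/
noncomputable def comulAux : H.toSubalgebra →ₗ[K] H.toSubalgebra ⊗[K] H.toSubalgebra :=
  (LinearEquiv.ofInjective _ H.map_incl_injective).symm.toLinearMap ∘ₗ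
    (Coalgebra.comul (R := K) ∘ₗ H.incl).codRestrict _ H.exists_comul

theorem map_comulAux (a : H.toSubalgebra) :
    TensorProduct.map H.incl H.incl (H.comulAux a) = Coalgebra.comul (R := K) (a : E) := by
  have h := LinearEquiv.apply_symm_apply (LinearEquiv.ofInjective _ H.map_incl_injective)
    ((Coalgebra.comul (R := K) ∘ₗ H.incl).codRestrict _ H.exists_comul a)
  exact congrArg Subtype.val h

theorem map_comp_comulAux :
    TensorProduct.map H.incl H.incl ∘ₗ H.comulAux = Coalgebra.comul (R := K) ∘ₗ H.incl :=
  LinearMap.ext H.map_comulAux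

/-- A Hopf subalgebra is a coalgebra under the restricted comultiplication and counit. -/
noncomputable instance instCoalgebra : Coalgebra K H.toSubalgebra where
  comul := H.comulAux
  counit := Coalgebra.counit (R := K) ∘ₗ H.incl
  coassoc := by
    have key : Function.Injective
        (TensorProduct.map H.incl (TensorProduct.map H.incl H.incl)) :=
      TensorProduct.map_injective_of_flat_flat _ _ H.incl_injective H.map_incl_injective
    ext a
    apply key
    have h1 : TensorProduct.map H.incl (TensorProduct.map H.incl H.incl)
        (TensorProduct.assoc K _ _ _ (H.comulAux.rTensor _ (H.comulAux a))) =
        TensorProduct.assoc K _ _ _ (Coalgebra.comul.rTensor E (Coalgebra.comul (R := K) (a : E))) := by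
      rw [← H.map_comulAux a]
      generalize H.comulAux a = t
      induction t with
      | zero => simp only [LinearMap.map_zero, LinearEquiv.map_zero]
      | add x y hx hy => simp only [LinearMap.map_add, LinearEquiv.map_add, hx, hy]
      | tmul x y =>
        simp only [LinearMap.rTensor_tmul, TensorProduct.map_tmul]
        have : Coalgebra.comul (R := K) (H.incl x) = _ := (H.map_comulAux x).symm
        rw [this]
        generalize H.comulAux x = s
        induction s with
        | zero => simp only [TensorProduct.zero_tmul, LinearMap.map_zero, LinearEquiv.map_zero]
        | add x y hx hy =>
          simp only [LinearMap.map_add, LinearEquiv.map_add, TensorProduct.add_tmul, hx, hy]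
        | tmul x y => simp only [TensorProduct.map_tmul, TensorProduct.assoc_tmul]
    have h2 : TensorProduct.map H.incl (TensorProduct.map H.incl H.incl)
        (H.comulAux.lTensor _ (H.comulAux a)) =
        Coalgebra.comul.lTensor E (Coalgebra.comul (R := K) (a : E)) := by
      rw [← H.map_comulAux a]
      generalize H.comulAux a = t
      induction t with
      | zero => simp only [LinearMap.map_zero]
      | add x y hx hy => simp only [LinearMap.map_add, hx, hy]
      | tmul x y =>
        simp only [LinearMap.lTensor_tmul, TensorProduct.map_tmul]
        rw [H.map_comulAux y]
        rfl
    simp only [LinearMap.comp_apply, LinearEquiv.coe_coe]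
    rw [h1, h2, Coalgebra.coassoc_apply]
  rTensor_counit_comp_comul := by
    ext a
    apply Module.Flat.lTensor_preserves_injective_linearMap (M := K) H.incl H.incl_injective
    have h : H.incl.lTensor K
        ((Coalgebra.counit (R := K) ∘ₗ H.incl).rTensor _ (H.comulAux a)) =
        Coalgebra.counit.rTensor E (Coalgebra.comul (R := K) (a : E)) := by
      rw [← H.map_comulAux a]
      generalize H.comulAux a = t
      induction t with
      | zero => simp
      | add x y hx hy => simp only [map_add, hx, hy]
      | tmul x y => simp
    simp only [LinearMap.comp_apply]
    simpa using h
  lTensor_counit_comp_comul := by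
    ext a
    apply Module.Flat.rTensor_preserves_injective_linearMap (M := K) H.incl H.incl_injective
    have h : H.incl.rTensor K
        ((Coalgebra.counit (R := K) ∘ₗ H.incl).lTensor _ (H.comulAux a)) =
        Coalgebra.counit.lTensor E (Coalgebra.comul (R := K) (a : E)) := by
      rw [← H.map_comulAux a]
      generalize H.comulAux a = t
      induction t with
      | zero => simp
      | add x y hx hy => simp only [map_add, hx, hy]
      | tmul x y => simp
    simp only [LinearMap.comp_apply]
    simpa using h

end HopfSubalgebra

section WeakProjections

variable {K : Type u} [Field K] {E : Type v} [Ring E] [HopfAlgebra K E]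

/-- A weak projection of `E` onto a Hopf subalgebra `H`: a left `H`-linear coalgebra map `E → H`
that restricts to the identity on `H`. -/
structure WeakProjection (H : HopfSubalgebra K E) extends E →ₗc[K] H.toSubalgebra where
  map_mul_left : ∀ (h : H.toSubalgebra) (e : E), toFun ((h : E) * e) = h * toFun e
  map_coe : ∀ h : H.toSubalgebra, toFun (h : E) = h

theorem adjoin_isSubcoalgebra {x : E} (hx : x ∈ primitives K E) :
    IsSubcoalgebra K (Subalgebra.toSubmodule (Algebra.adjoin K {x})) := by
  set A := Algebra.adjoin K {x} with hA
  have hxA : x ∈ A := Algebra.subset_adjoin rfl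
  have hle : A ≤ (Algebra.TensorProduct.map A.val A.val).range.comap
      (Bialgebra.comulAlgHom K E) := by
    rw [hA, Algebra.adjoin_le_iff, Set.singleton_subset_iff]
    refine ⟨(⟨x, hxA⟩ : A) ⊗ₜ 1 + 1 ⊗ₜ (⟨x, hxA⟩ : A), ?_⟩
    have hx' : Coalgebra.comul (R := K) x = x ⊗ₜ[K] (1 : E) + (1 : E) ⊗ₜ[K] x := hx
    simp [hx']
  intro c hc
  obtain ⟨t, ht⟩ := hle hc
  exact ⟨t, ht⟩

theorem antipode_of_mem_primitives {x : E} (hx : x ∈ primitives K E) :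
    HopfAlgebra.antipode K x = -x := by
  have hx' : Coalgebra.comul (R := K) x = x ⊗ₜ[K] (1 : E) + (1 : E) ⊗ₜ[K] x := hx
  have h0 : Coalgebra.counit (R := K) x = 0 := by
    have h := Coalgebra.rTensor_counit_comul (R := K) x
    rw [hx'] at h
    have h2 := congrArg (TensorProduct.lid K E) h
    simp at h2
    rcases h2 with h2 | h2
    · exact h2
    · rw [← mul_one x, h2, mul_zero, map_zero]
  have h := HopfAlgebra.mul_antipode_rTensor_comul_apply (R := K) x
  rw [hx', h0] at h
  simp at h
  exact eq_neg_of_add_eq_zero_left h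

theorem antipode_mem_adjoin {x : E} (hx : x ∈ primitives K E) (a : E)
    (ha : a ∈ Algebra.adjoin K {x}) : HopfAlgebra.antipode K a ∈ Algebra.adjoin K {x} := by
  induction ha using Algebra.adjoin_induction with
  | mem y hy =>
    rw [Set.mem_singleton_iff] at hy
    subst hy
    rw [antipode_of_mem_primitives hx]
    exact neg_mem (Algebra.subset_adjoin rfl)
  | algebraMap r =>
    rw [Algebra.algebraMap_eq_smul_one, map_smul, HopfAlgebra.antipode_one]
    exact Subalgebra.smul_mem _ (one_mem _) _
  | add y z _ _ hy hz => rw [map_add]; exact add_mem hy hz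
  | mul y z _ _ hy hz => rw [HopfAlgebra.antipode_mul_antidistrib]; exact mul_mem hz hy

/-- For a primitive element `x`, the Hopf subalgebra `K[x]` of `E`: the subalgebra generated
by `x`. -/
def adjoinPrimitive (x : E) (hx : x ∈ primitives K E) : HopfSubalgebra K E where
  toSubalgebra := Algebra.adjoin K {x}
  isSubcoalgebra := adjoin_isSubcoalgebra hx
  antipode_mem := antipode_mem_adjoin hx

variable (K) in
/-- The right ideal `xE` of `E`, as a subspace. -/
def rightIdeal (x : E) : Submodule K E :=
  LinearMap.range (LinearMap.mulLeft K x)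

end WeakProjections

end ConnectedHopf

/-! The operators commuting with `Δ` as `(T ⊗ 1)Δ = ΔT` form an algebra A, a copy of the opposite of
the dual algebra of E: each T is recovered from the functional `ε ∘ T`. Write I for the ideal of
those T with `T 1 = 0`, and D for the derivation `T ↦ [T, x]`, where x acts by left multiplication.
Everything rests on a T in I with D T = 1, a "d/dx" on E. Connectedness makes I act locally
nilpotently (`exists_augmentationIdeal_pow_apply_eq_zero`), so T is locally nilpotent and Taylor
expansion terminates. Then `e ↦ ∑ ε(Tⁿ e) xⁿ/n!` is the weak projection, and E is freely spanned by
the `xⁿ/n!` over ker T, a complement of xE. To find T, one first shows that x is left cancellable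
(`mulLeft_primitive_injective`), by integrating by parts along the I-adic filtration. A left inverse
of multiplication by x, followed by ε, is then the functional that defines T
(`exists_commutator_eq_one`). -/

namespace ConnectedHopf

/-! ### Operators on a coalgebra coming from its dual -/

section CoalgebraOperators

variable (K : Type u) [Field K] (C : Type v) [AddCommGroup C] [Module K C] [Coalgebra K C]

/-- The operators `T` with `Δ T = (T ⊗ 1) Δ`. -/
def leftOperators : Subalgebra K (Module.End K C) where
  carrier := {T | ∀ c, Coalgebra.comul (R := K) (T c) = T.rTensor C (Coalgebra.comul c)}
  mul_mem' := by
    intro S T hS hT c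
    simp only [Set.mem_ofPred_eq] at hS hT
    rw [Module.End.mul_apply, hS, hT, Module.End.mul_eq_comp, LinearMap.rTensor_comp_apply]
  add_mem' := by
    intro S T hS hT c
    simp only [Set.mem_ofPred_eq] at hS hT
    simp [hS, hT, LinearMap.rTensor_add]
  algebraMap_mem' := by
    intro r c
    simp [Algebra.algebraMap_eq_smul_one, LinearMap.rTensor_smul, Module.End.one_eq_id]

/-- The operators `T` with `Δ T = (1 ⊗ T) Δ`. -/
def rightOperators : Subalgebra K (Module.End K C) where
  carrier := {T | ∀ c, Coalgebra.comul (R := K) (T c) = T.lTensor C (Coalgebra.comul c)}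
  mul_mem' := by
    intro S T hS hT c
    simp only [Set.mem_ofPred_eq] at hS hT
    rw [Module.End.mul_apply, hS, hT, Module.End.mul_eq_comp, LinearMap.lTensor_comp_apply]
  add_mem' := by
    intro S T hS hT c
    simp only [Set.mem_ofPred_eq] at hS hT
    simp [hS, hT, LinearMap.lTensor_add]
  algebraMap_mem' := by
    intro r c
    simp [Algebra.algebraMap_eq_smul_one, LinearMap.lTensor_smul, Module.End.one_eq_id]

variable {K C}

theorem comul_leftOperator (T : leftOperators K C) (c : C) :
    Coalgebra.comul (R := K) (T.1 c) = T.1.rTensor C (Coalgebra.comul c) := T.2 c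

theorem comul_rightOperator (T : rightOperators K C) (c : C) :
    Coalgebra.comul (R := K) (T.1 c) = T.1.lTensor C (Coalgebra.comul c) := T.2 c

/-- The operator `c ↦ f(c₁) c₂`. -/
noncomputable def leftOperator (f : Module.Dual K C) : leftOperators K C :=
  ⟨(TensorProduct.lid K C).toLinearMap ∘ₗ f.rTensor C ∘ₗ Coalgebra.comul, by
    intro c
    simp only [LinearMap.comp_apply, LinearMap.rTensor_comp_apply, LinearEquiv.coe_coe]
    have h := Coalgebra.coassoc_symm_apply (R := K) c
    have key : ∀ t : C ⊗[K] C, Coalgebra.comul (R := K) (TensorProduct.lid K C (f.rTensor C t)) =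
        (TensorProduct.lid K C).toLinearMap.rTensor C ((f.rTensor C).rTensor C
          ((TensorProduct.assoc K C C C).symm (Coalgebra.comul.lTensor C t))) := by
      intro t
      induction t with
      | zero => simp
      | add y z hy hz => simp only [map_add, hy, hz]
      | tmul y z =>
        simp only [LinearMap.rTensor_tmul, LinearMap.lTensor_tmul, TensorProduct.lid_tmul, map_smul]
        generalize Coalgebra.comul (R := K) z = s
        induction s with
        | zero => simp
        | add p q hp hq => simp only [TensorProduct.tmul_add, map_add, smul_add, hp, hq]
        | tmul p q => simp [TensorProduct.smul_tmul']
    rw [key, h]⟩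

/-- The operator `c ↦ c₁ f(c₂)`. -/
noncomputable def rightOperator (f : Module.Dual K C) : rightOperators K C :=
  ⟨(TensorProduct.rid K C).toLinearMap ∘ₗ f.lTensor C ∘ₗ Coalgebra.comul, by
    intro c
    simp only [LinearMap.comp_apply, LinearMap.lTensor_comp_apply, LinearEquiv.coe_coe]
    have h := Coalgebra.coassoc_apply (R := K) c
    have key : ∀ t : C ⊗[K] C, Coalgebra.comul (R := K) (TensorProduct.rid K C (f.lTensor C t)) =
        (TensorProduct.rid K C).toLinearMap.lTensor C ((f.lTensor C).lTensor C
          ((TensorProduct.assoc K C C C) (Coalgebra.comul.rTensor C t))) := by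
      intro t
      induction t with
      | zero => simp
      | add y z hy hz => simp only [map_add, hy, hz]
      | tmul y z =>
        simp only [LinearMap.rTensor_tmul, LinearMap.lTensor_tmul, TensorProduct.rid_tmul, map_smul]
        generalize Coalgebra.comul (R := K) y = s
        induction s with
        | zero => simp
        | add p q hp hq => simp only [TensorProduct.add_tmul, map_add, smul_add, hp, hq]
        | tmul p q => simp [TensorProduct.tmul_smul]
    rw [key, h]⟩

theorem leftOperator_apply (f : Module.Dual K C) (c : C) :
    (leftOperator f).1 c = TensorProduct.lid K C (f.rTensor C (Coalgebra.comul c)) := rfl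

theorem rightOperator_apply (f : Module.Dual K C) (c : C) :
    (rightOperator f).1 c = TensorProduct.rid K C (f.lTensor C (Coalgebra.comul c)) := rfl

theorem counit_leftOperator (f : Module.Dual K C) (c : C) :
    Coalgebra.counit (R := K) ((leftOperator f).1 c) = f c := by
  rw [leftOperator_apply]
  have key : ∀ t : C ⊗[K] C, Coalgebra.counit (R := K) (TensorProduct.lid K C (f.rTensor C t)) =
      f (TensorProduct.rid K C (Coalgebra.counit.lTensor C t)) := by
    intro t
    induction t with
    | zero => simp
    | add y z hy hz => simp only [map_add, hy, hz]
    | tmul y z => simp [mul_comm]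
  rw [key, Coalgebra.lTensor_counit_comul]
  simp

theorem counit_rightOperator (f : Module.Dual K C) (c : C) :
    Coalgebra.counit (R := K) ((rightOperator f).1 c) = f c := by
  rw [rightOperator_apply]
  have key : ∀ t : C ⊗[K] C, Coalgebra.counit (R := K) (TensorProduct.rid K C (f.lTensor C t)) =
      f (TensorProduct.lid K C (Coalgebra.counit.rTensor C t)) := by
    intro t
    induction t with
    | zero => simp
    | add y z hy hz => simp only [map_add, hy, hz]
    | tmul y z => simp [mul_comm]
  rw [key, Coalgebra.rTensor_counit_comul]
  simp

/-- By the counit axiom a left operator is determined by its composite with ε; identities between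
left operators can thus be tested after applying ε. -/
theorem leftOperator_counit_comp (T : leftOperators K C) :
    leftOperator (Coalgebra.counit ∘ₗ T.1) = T := by
  ext c
  rw [leftOperator_apply, LinearMap.rTensor_comp_apply, ← comul_leftOperator,
    Coalgebra.rTensor_counit_comul]
  simp

theorem rightOperator_counit_comp (T : rightOperators K C) :
    rightOperator (Coalgebra.counit ∘ₗ T.1) = T := by
  ext c
  rw [rightOperator_apply, LinearMap.lTensor_comp_apply, ← comul_rightOperator,
    Coalgebra.lTensor_counit_comul]
  simp

theorem leftOperators_comm_rightOperators (T : leftOperators K C) (S : rightOperators K C) (c : C) :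
    T.1 (S.1 c) = S.1 (T.1 c) := by
  rw [← leftOperator_counit_comp T]
  generalize Coalgebra.counit ∘ₗ T.1 = f
  rw [leftOperator_apply, leftOperator_apply, comul_rightOperator]
  generalize Coalgebra.comul (R := K) c = t
  induction t with
  | zero => simp
  | add y z hy hz => simp only [map_add, hy, hz]
  | tmul y z => simp

/-- A right operator, as a linear map over the algebra of left operators. -/
def rightOperatorHom (S : rightOperators K C) : C →ₗ[leftOperators K C] C where
  toFun := S.1
  map_add' := map_add S.1
  map_smul' T c := (leftOperators_comm_rightOperators T S c).symm

@[simp] theorem rightOperatorHom_apply (S : rightOperators K C) (c : C) :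
    rightOperatorHom S c = S.1 c := rfl

/-- Local finiteness: the second legs of one expression of `Δ c` as a finite sum span a space
containing the whole orbit of c. -/
theorem exists_finiteDimensional_leftOperators (c : C) :
    ∃ V : Submodule K C, FiniteDimensional K V ∧ ∀ T : leftOperators K C, T.1 c ∈ V := by
  have key : ∀ t : C ⊗[K] C, ∃ V : Submodule K C, FiniteDimensional K V ∧
      ∀ f : Module.Dual K C, TensorProduct.lid K C (f.rTensor C t) ∈ V := by
    intro t
    induction t with
    | zero => exact ⟨⊥, inferInstance, by simp⟩
    | add y z hy hz =>
      obtain ⟨V, hV, h⟩ := hy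
      obtain ⟨W, hW, h'⟩ := hz
      exact ⟨V ⊔ W, inferInstance, fun f ↦ by
        simpa only [map_add] using Submodule.add_mem_sup (h f) (h' f)⟩
    | tmul y z =>
      exact ⟨K ∙ z, inferInstance, fun f ↦ by
        simpa using Submodule.smul_mem _ _ (Submodule.mem_span_singleton_self z)⟩
  obtain ⟨V, hV, h⟩ := key (Coalgebra.comul c)
  refine ⟨V, hV, fun T ↦ ?_⟩
  rw [← leftOperator_counit_comp T]
  exact h _

theorem exists_finiteDimensional_rightOperators (c : C) :
    ∃ V : Submodule K C, FiniteDimensional K V ∧ ∀ T : rightOperators K C, T.1 c ∈ V := by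
  have key : ∀ t : C ⊗[K] C, ∃ V : Submodule K C, FiniteDimensional K V ∧
      ∀ f : Module.Dual K C, TensorProduct.rid K C (f.lTensor C t) ∈ V := by
    intro t
    induction t with
    | zero => exact ⟨⊥, inferInstance, by simp⟩
    | add y z hy hz =>
      obtain ⟨V, hV, h⟩ := hy
      obtain ⟨W, hW, h'⟩ := hz
      exact ⟨V ⊔ W, inferInstance, fun f ↦ by
        simpa only [map_add] using Submodule.add_mem_sup (h f) (h' f)⟩
    | tmul y z =>
      exact ⟨K ∙ y, inferInstance, fun f ↦ by
        simpa using Submodule.smul_mem _ _ (Submodule.mem_span_singleton_self y)⟩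
  obtain ⟨V, hV, h⟩ := key (Coalgebra.comul c)
  refine ⟨V, hV, fun T ↦ ?_⟩
  rw [← rightOperator_counit_comp T]
  exact h _

theorem exists_finiteDimensional_map_rightOperators (X : Submodule K C) [FiniteDimensional K X] :
    ∃ V : Submodule K C, FiniteDimensional K V ∧ ∀ T : rightOperators K C, X.map T.1 ≤ V := by
  obtain ⟨s, rfl⟩ := (Submodule.fg_iff_finiteDimensional X).2 inferInstance
  choose V hV h using exists_finiteDimensional_rightOperators (K := K) (C := C)
  refine ⟨⨆ y : s, V y, inferInstance, fun T ↦ ?_⟩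
  rw [Submodule.map_span_le]
  intro y hy
  exact le_iSup (fun y : s ↦ V y) ⟨y, hy⟩ (h y T)

theorem tensor_ext_left {V W : Type*} [AddCommGroup V] [Module K V] [AddCommGroup W] [Module K W]
    {s t : V ⊗[K] W} (h : ∀ f : Module.Dual K V, TensorProduct.lid K W (f.rTensor W s) =
      TensorProduct.lid K W (f.rTensor W t)) : s = t := by
  classical
  let b := Module.Basis.ofVectorSpace K V
  apply (TensorProduct.equivFinsuppOfBasisLeft b).injective
  have key (r : V ⊗[K] W) (i) : TensorProduct.equivFinsuppOfBasisLeft b r i =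
      TensorProduct.lid K W ((b.coord i).rTensor W r) := by
    induction r with
    | zero => simp
    | add y z hy hz => simp only [map_add, Finsupp.add_apply, hy, hz]
    | tmul y z => simp
  ext i
  rw [key, key, h]

theorem tensor_ext_right {V W : Type*} [AddCommGroup V] [Module K V] [AddCommGroup W] [Module K W]
    {s t : V ⊗[K] W} (h : ∀ f : Module.Dual K W, TensorProduct.rid K V (f.lTensor V s) =
      TensorProduct.rid K V (f.lTensor V t)) : s = t := by
  classical
  let b := Module.Basis.ofVectorSpace K W
  apply (TensorProduct.equivFinsuppOfBasisRight b).injective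
  have key (r : V ⊗[K] W) (i) : TensorProduct.equivFinsuppOfBasisRight b r i =
      TensorProduct.rid K V ((b.coord i).lTensor V r) := by
    induction r with
    | zero => simp
    | add y z hy hz => simp only [map_add, Finsupp.add_apply, hy, hz]
    | tmul y z => simp
  ext i
  rw [key, key, h]

/-- Let p be a linear projection onto V. Slicing `Δ c` by functionals on the left factor gives left
orbits, which p fixes, so `1 ⊗ p` fixes `Δ c`. Right stability gives the same for `p ⊗ 1`. -/
theorem isSubcoalgebra_of_stable {V : Submodule K C}
    (hl : ∀ (T : leftOperators K C), ∀ c ∈ V, T.1 c ∈ V)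
    (hr : ∀ (T : rightOperators K C), ∀ c ∈ V, T.1 c ∈ V) : IsSubcoalgebra K V := by
  intro c hc
  obtain ⟨p, hp⟩ := V.subtype.exists_leftInverse_of_injective V.ker_subtype
  have hp' : ∀ y ∈ V, V.subtype (p y) = y := fun y hy ↦
    congrArg Subtype.val (LinearMap.congr_fun hp ⟨y, hy⟩)
  have h1 : (V.subtype ∘ₗ p).lTensor C (Coalgebra.comul (R := K) c) = Coalgebra.comul c := by
    apply tensor_ext_left
    intro f
    have key : ∀ t : C ⊗[K] C, TensorProduct.lid K C
        (f.rTensor C ((V.subtype ∘ₗ p).lTensor C t)) =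
        V.subtype (p (TensorProduct.lid K C (f.rTensor C t))) := by
      intro t
      induction t with
      | zero => simp
      | add y z hy hz => simp only [map_add, hy, hz]
      | tmul y z => simp
    rw [key, ← leftOperator_apply]
    exact hp' _ (hl _ _ hc)
  have h2 : (V.subtype ∘ₗ p).rTensor C (Coalgebra.comul (R := K) c) = Coalgebra.comul c := by
    apply tensor_ext_right
    intro f
    have key : ∀ t : C ⊗[K] C, TensorProduct.rid K C
        (f.lTensor C ((V.subtype ∘ₗ p).rTensor C t)) =
        V.subtype (p (TensorProduct.rid K C (f.lTensor C t))) := by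
      intro t
      induction t with
      | zero => simp
      | add y z hy hz => simp only [map_add, hy, hz]
      | tmul y z => simp
    rw [key, ← rightOperator_apply]
    exact hp' _ (hr _ _ hc)
  refine ⟨TensorProduct.map p p (Coalgebra.comul c), ?_⟩
  rw [← LinearMap.comp_apply, ← TensorProduct.map_comp]
  conv_rhs => rw [← h1, ← h2]
  rw [← LinearMap.comp_apply (LinearMap.lTensor _ _), LinearMap.lTensor_comp_rTensor]

theorem exists_isSimpleSubcoalgebra_le (V : Submodule K C) [FiniteDimensional K V]
    (hV : IsSubcoalgebra K V) (h0 : V ≠ ⊥) : ∃ W ≤ V, IsSimpleSubcoalgebra K W := by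
  induction h : Module.finrank K V using Nat.strong_induction_on generalizing V with
  | _ n ih =>
    by_cases hs : ∀ W : Submodule K C, IsSubcoalgebra K W → W ≤ V → W = ⊥ ∨ W = V
    · exact ⟨V, le_rfl, hV, h0, hs⟩
    · push Not at hs
      obtain ⟨W, hW, hle, hW0, hne⟩ := hs
      have := Submodule.finiteDimensional_of_le hle
      obtain ⟨U, hU, hU'⟩ := ih _ (h ▸ Submodule.finrank_lt_finrank_of_lt (hle.lt_of_ne hne))
        W hW hW0 rfl
      exact ⟨U, hU.trans hle, hU'⟩

end CoalgebraOperators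

/-! ### Connectedness and local nilpotency of the augmentation ideal -/

section LocalNilpotency

variable (K : Type u) [Field K] (E : Type v) [Ring E] [HopfAlgebra K E]

instance : Ring (leftOperators K E) := Subalgebra.toRing _

theorem counit_one_eq : Coalgebra.counit (R := K) (1 : E) = 1 := Bialgebra.counit_one

theorem nontrivial_of_hopfAlgebra (K : Type u) [Field K] (E : Type v) [Ring E]
    [HopfAlgebra K E] : Nontrivial E := by
  refine ⟨1, 0, fun h ↦ ?_⟩
  have := counit_one_eq K E
  rw [h, map_zero] at this
  exact zero_ne_one this

/-- The ideal of left operators that annihilate `1`. -/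
def augmentationIdeal : Ideal (leftOperators K E) where
  carrier := {T | T.1 1 = 0}
  add_mem' := by
    intro S T hS hT
    simp only [Set.mem_ofPred_eq] at hS hT ⊢
    simp [hS, hT]
  zero_mem' := by simp
  smul_mem' := by
    intro S T hT
    simp only [Set.mem_ofPred_eq] at hT ⊢
    simp [hT]

variable {K E}

theorem mem_augmentationIdeal {T : leftOperators K E} :
    T ∈ augmentationIdeal K E ↔ T.1 1 = 0 := Iff.rfl

theorem leftOperator_one (f : Module.Dual K E) : (leftOperator f).1 1 = f 1 • (1 : E) := by
  rw [leftOperator_apply, Bialgebra.comul_one, Algebra.TensorProduct.one_def]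
  simp

theorem leftOperators_apply_one (T : leftOperators K E) :
    T.1 1 = Coalgebra.counit (R := K) (T.1 1) • (1 : E) := by
  conv_lhs => rw [← leftOperator_counit_comp T, leftOperator_one]
  rfl

instance : (augmentationIdeal K E).IsTwoSided where
  mul_mem_of_left := by
    intro S T hS
    rw [mem_augmentationIdeal] at hS ⊢
    change S.1 (T.1 1) = 0
    rw [leftOperators_apply_one T, map_smul, hS, smul_zero]

theorem isSimpleSubcoalgebra_span_one : IsSimpleSubcoalgebra K (K ∙ (1 : E)) := by
  have := nontrivial_of_hopfAlgebra K E
  refine ⟨?_, by simp, fun W _ hW ↦ ?_⟩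
  · intro c hc
    obtain ⟨r, rfl⟩ := Submodule.mem_span_singleton.1 hc
    refine ⟨r • (⟨1, Submodule.mem_span_singleton_self 1⟩ ⊗ₜ
      ⟨1, Submodule.mem_span_singleton_self 1⟩), ?_⟩
    simp [Algebra.TensorProduct.one_def]
  · exact (nonzero_span_atom (1 : E) one_ne_zero).le_iff.1 hW

theorem coradical_eq_span_one (h : IsConnected K E) : coradical K E = K ∙ (1 : E) := by
  have := nontrivial_of_hopfAlgebra K E
  have hfin : FiniteDimensional K (coradical K E) :=
    Module.finite_of_finrank_pos (by rw [show Module.finrank K (coradical K E) = 1 from h]; simp)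
  have hle : K ∙ (1 : E) ≤ coradical K E :=
    le_sSup (isSimpleSubcoalgebra_span_one (K := K) (E := E))
  refine (Submodule.eq_of_le_of_finrank_eq hle ?_).symm
  rw [finrank_span_singleton one_ne_zero]
  exact h.symm

/-- V contains a simple subcoalgebra, which lies in the coradical `K·1` and hence equals it. -/
theorem one_mem_of_isSubcoalgebra (h : IsConnected K E) (V : Submodule K E)
    [FiniteDimensional K V] (hV : IsSubcoalgebra K V) (h0 : V ≠ ⊥) : (1 : E) ∈ V := by
  have := nontrivial_of_hopfAlgebra K E
  obtain ⟨W, hW, hs⟩ := exists_isSimpleSubcoalgebra_le V hV h0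
  have hle : W ≤ K ∙ (1 : E) := coradical_eq_span_one h ▸ le_sSup hs
  obtain rfl := ((nonzero_span_atom (1 : E) one_ne_zero).le_iff.1 hle).resolve_left hs.2.1
  exact hW (Submodule.mem_span_singleton_self 1)

theorem mem_span_leftOperators_one {y : E} (hy : y ∈ Submodule.span (leftOperators K E) {(1 : E)}) :
    ∀ T ∈ augmentationIdeal K E, T • y = 0 := by
  intro T hT
  obtain ⟨S, rfl⟩ := Submodule.mem_span_singleton.1 hy
  rw [smul_smul]
  exact (augmentationIdeal K E).mul_mem_right S hT

instance isSimpleModule_span_one :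
    IsSimpleModule (leftOperators K E) (Submodule.span (leftOperators K E) {(1 : E)}) := by
  have := nontrivial_of_hopfAlgebra K E
  rw [isSimpleModule_iff_isAtom]
  refine ⟨by simp, fun W hW ↦ ?_⟩
  by_contra hne
  obtain ⟨w, hw, hw0⟩ := Submodule.exists_mem_ne_zero_of_ne_bot hne
  refine hW.not_ge ?_
  obtain ⟨T, rfl⟩ := Submodule.mem_span_singleton.1 (hW.le hw)
  rw [Submodule.span_singleton_le_iff_mem]
  change T.1 1 ∈ W at hw
  change T.1 1 ≠ 0 at hw0
  rw [leftOperators_apply_one] at hw hw0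
  generalize Coalgebra.counit (R := K) (T.1 1) = r at hw hw0
  have hr : r ≠ 0 := by rintro rfl; simp at hw0
  have := W.smul_mem (algebraMap K (leftOperators K E) r⁻¹) hw
  simpa [smul_smul, hr] using this

/-- The simple images of U under right operators sum to a nonzero finite-dimensional subcoalgebra,
which contains 1. So `A·1`, on which I vanishes, is isomorphic to one of these images; if `I U = U`,
that image would be both killed by I and equal to I times itself. -/
theorem augmentationIdeal_smul_ne_self (h : IsConnected K E)
    (U : Submodule (leftOperators K E) E) [IsSimpleModule (leftOperators K E) U]
    [FiniteDimensional K (U.restrictScalars K)] : augmentationIdeal K E • U ≠ U := by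
  intro hU
  have hU0 : U ≠ ⊥ := (isSimpleModule_iff_isAtom.1 inferInstance).1
  let s : Set (Submodule (leftOperators K E) E) :=
    {V | IsSimpleModule (leftOperators K E) V ∧
      ∃ S : rightOperators K E, V = U.map (rightOperatorHom S)}
  have hs : ∀ S : rightOperators K E, U.map (rightOperatorHom S) ≤ sSup s := by
    intro S
    by_cases hb : U.map (rightOperatorHom S) = ⊥
    · rw [hb]; exact bot_le
    · refine le_sSup ⟨?_, S, rfl⟩
      have : Function.Injective ((rightOperatorHom S).submoduleMap U) := by
        refine (LinearMap.injective_or_eq_zero _).resolve_right fun h0 ↦ hb ?_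
        rw [eq_bot_iff]
        rintro _ ⟨y, hy, rfl⟩
        exact congrArg Subtype.val (LinearMap.congr_fun h0 ⟨y, hy⟩)
      exact (LinearEquiv.isSimpleModule_iff (LinearEquiv.ofBijective _
        ⟨this, (rightOperatorHom S).submoduleMap_surjective U⟩)).1 inferInstance
  obtain ⟨X, hX, hUX⟩ := exists_finiteDimensional_map_rightOperators (U.restrictScalars K)
  have hfin : FiniteDimensional K ((sSup s).restrictScalars K) := by
    -- The largest A-submodule inside X; it contains every image of U because left and right
    -- operators commute.
    let Y : Submodule (leftOperators K E) E :=
      { carrier := {c | ∀ T : leftOperators K E, T.1 c ∈ X}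
        add_mem' := fun ha hb T ↦ by rw [map_add]; exact X.add_mem (ha T) (hb T)
        zero_mem' := fun T ↦ by rw [map_zero]; exact X.zero_mem
        smul_mem' := fun S c hc T ↦ hc (T * S) }
    have hY : sSup s ≤ Y := by
      refine sSup_le ?_
      rintro _ ⟨_, S, rfl⟩ _ ⟨y, hy, rfl⟩ T
      rw [rightOperatorHom_apply, leftOperators_comm_rightOperators]
      exact hUX S ⟨_, U.smul_mem T hy, rfl⟩
    exact Submodule.finiteDimensional_of_le (S₂ := X) fun c hc ↦ hY hc 1
  have hstable : ∀ T : rightOperators K E, ∀ c ∈ sSup s, T.1 c ∈ sSup s := by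
    intro T
    have : sSup s ≤ (sSup s).comap (rightOperatorHom T) := by
      refine sSup_le ?_
      rintro _ ⟨_, S, rfl⟩ 
      rw [Submodule.map_le_iff_le_comap]
      intro y hy
      exact hs (T * S) ⟨y, hy, rfl⟩
    exact this
  have hsub : IsSubcoalgebra K ((sSup s).restrictScalars K) :=
    isSubcoalgebra_of_stable (fun T c hc ↦ (sSup s).smul_mem T hc) hstable
  have hne : (sSup s).restrictScalars K ≠ ⊥ := by
    intro h0
    refine hU0 (eq_bot_iff.2 fun y hy ↦ ?_)
    have : y ∈ (sSup s).restrictScalars K := hs 1 ⟨y, hy, rfl⟩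
    rwa [h0] at this
  have h1 := one_mem_of_isSubcoalgebra h _ hsub hne
  have hsimple : ∀ V : s, IsSimpleModule (leftOperators K E) V := fun V ↦ V.2.1
  obtain ⟨V, ⟨_, S, rfl⟩, ⟨e⟩⟩ := Submodule.linearEquiv_of_le_sSup
    (Submodule.span (leftOperators K E) {(1 : E)}) s
    (by rwa [Submodule.span_singleton_le_iff_mem])
  have hbot : U.map (rightOperatorHom S) = ⊥ := by
    rw [← hU, Submodule.map_smul'', eq_bot_iff, Submodule.smul_le]
    intro T hT y hy
    have := mem_span_leftOperators_one (e.symm ⟨y, hy⟩).2 T hT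
    have h2 : T • (⟨y, hy⟩ : U.map (rightOperatorHom S)) = 0 := by
      rw [← e.symm.map_eq_zero_iff, map_smul]
      exact Subtype.ext this
    exact congrArg Subtype.val h2
  have := hsimple ⟨_, ‹_›, S, rfl⟩
  exact (isSimpleModule_iff_isAtom.1 this).1 hbot

/-- Quotients of W are turned into submodules of E: a functional vanishing on a maximal submodule M,
but not on W, defines a right operator whose kernel on W is exactly M, so its image is W/M. -/
theorem exists_isSimpleModule_map_rightOperator (W : Submodule (leftOperators K E) E)
    [FiniteDimensional K (W.restrictScalars K)] (hW0 : W ≠ ⊥) :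
    ∃ S : rightOperators K E, IsSimpleModule (leftOperators K E) (W.map (rightOperatorHom S)) := by
  have hWfin : Module.Finite K W := inferInstanceAs (Module.Finite K (W.restrictScalars K))
  have : IsNoetherian (leftOperators K E) W := isNoetherian_of_tower K inferInstance
  have : Nontrivial W := Submodule.nontrivial_iff_ne_bot.2 hW0
  obtain ⟨M, hM⟩ : ∃ M : Submodule (leftOperators K E) W, IsCoatom M :=
    (IsCoatomic.exists_coatom _)
  obtain ⟨w, hw⟩ : ∃ w : W, w ∉ M := by
    by_contra! hall
    exact hM.1 (eq_top_iff.2 fun y _ ↦ hall y)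
  obtain ⟨φ, hφw, hφ⟩ : ∃ φ : Module.Dual K E, φ w ≠ 0 ∧ ∀ y ∈ M, φ y = 0 := by
    obtain ⟨φ, h1, h2⟩ := Submodule.exists_le_ker_of_notMem
      (p := (M.map W.subtype).restrictScalars K) (v := (w : E)) (by
        rintro ⟨y, hy, hyw⟩
        exact hw (Subtype.ext hyw ▸ hy))
    exact ⟨φ, h1, fun y hy ↦ h2 ⟨y, hy, rfl⟩⟩
  let ρ := (rightOperatorHom (rightOperator φ)).submoduleMap W
  have hρ : ∀ y, (ρ y : E) = (rightOperator φ).1 y := fun y ↦ rfl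
  have hker : LinearMap.ker ρ = M := by
    have hMle : M ≤ LinearMap.ker ρ := by
      intro y hy
      rw [LinearMap.mem_ker]
      refine Subtype.ext ?_
      rw [hρ, Submodule.coe_zero]
      refine (Module.forall_dual_apply_eq_zero_iff K _).1 fun f ↦ ?_
      -- `f(S y) = ε(L_f S y) = ε(S L_f y) = φ(L_f y)`, and `L_f y` stays in the submodule M.
      rw [← counit_leftOperator f, leftOperators_comm_rightOperators, counit_rightOperator]
      exact hφ _ (M.smul_mem (leftOperator f) hy)
    refine (hM.le_iff.1 hMle).resolve_left fun htop ↦ hφw ?_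
    have h0 : ρ w = 0 := by rw [← LinearMap.mem_ker, htop]; trivial
    rw [← counit_rightOperator, ← hρ, h0, Submodule.coe_zero, map_zero]
  have : IsSimpleModule (leftOperators K E) (W ⧸ LinearMap.ker ρ) := by
    rw [hker]
    exact isSimpleModule_iff_isCoatom.2 hM
  exact ⟨rightOperator φ, IsSimpleModule.congr
    (ρ.quotKerEquivOfSurjective (LinearMap.submoduleMap_surjective _ _)).symm⟩

theorem exists_pow_smul_eq_smul_pow_smul (I : Ideal (leftOperators K E)) [I.IsTwoSided]
    (V : Submodule (leftOperators K E) E) [FiniteDimensional K (V.restrictScalars K)] :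
    ∃ n : ℕ, I • (I ^ n • V) = I ^ n • V := by
  by_contra! hne
  have hle : ∀ n, I ^ n • V ≤ V := fun n ↦ Submodule.smul_le_right
  have hlt : ∀ n, I • (I ^ n • V) < I ^ n • V := fun n ↦
    lt_of_le_of_ne Submodule.smul_le_right (hne n)
  have hbound : ∀ n, Module.finrank K ((I ^ n • V).restrictScalars K) + n ≤
      Module.finrank K (V.restrictScalars K) := by
    intro n
    induction n with
    | zero => exact Submodule.finrank_mono (hle 0)
    | succ n ih =>
      have : FiniteDimensional K ((I ^ n • V).restrictScalars K) :=
        Submodule.finiteDimensional_of_le (S₂ := V.restrictScalars K) (hle n)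
      have h1 : Module.finrank K ((I ^ (n + 1) • V).restrictScalars K) <
          Module.finrank K ((I ^ n • V).restrictScalars K) := by
        apply Submodule.finrank_lt_finrank_of_lt
        rw [Ideal.IsTwoSided.pow_succ, Submodule.mul_smul]
        exact hlt n
      omega
  have := hbound (Module.finrank K (V.restrictScalars K) + 1)
  omega

/-- The powers of I applied to the finite-dimensional module `A e` stabilize at some W with `I W =
W`. Were W nonzero, a simple image U of it would satisfy `I U = U`. -/
theorem exists_augmentationIdeal_pow_apply_eq_zero (h : IsConnected K E) (e : E) :
    ∃ N : ℕ, ∀ T ∈ augmentationIdeal K E ^ N, T.1 e = 0 := by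
  let V : Submodule (leftOperators K E) E := Submodule.span _ {e}
  have hV : FiniteDimensional K (V.restrictScalars K) := by
    obtain ⟨X, hX, h⟩ := exists_finiteDimensional_leftOperators (K := K) e
    refine Submodule.finiteDimensional_of_le (S₂ := X) fun c hc ↦ ?_
    obtain ⟨T, rfl⟩ := Submodule.mem_span_singleton.1 hc
    exact h T
  obtain ⟨n, hn⟩ := exists_pow_smul_eq_smul_pow_smul (augmentationIdeal K E) V
  have hle : augmentationIdeal K E ^ n • V ≤ V := Submodule.smul_le_right
  refine ⟨n, fun T hT ↦ ?_⟩
  have hTe : T • e ∈ augmentationIdeal K E ^ n • V :=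
    Submodule.smul_mem_smul hT (Submodule.mem_span_singleton_self e)
  generalize augmentationIdeal K E ^ n • V = W at *
  have hW : FiniteDimensional K (W.restrictScalars K) :=
    Submodule.finiteDimensional_of_le (S₂ := V.restrictScalars K) hle
  by_contra hne
  obtain ⟨S, hS⟩ := exists_isSimpleModule_map_rightOperator W
    (Submodule.ne_bot_iff _ |>.2 ⟨_, hTe, hne⟩)
  have : FiniteDimensional K ((W.map (rightOperatorHom S)).restrictScalars K) :=
    inferInstanceAs (FiniteDimensional K ((W.restrictScalars K).map S.1))
  refine augmentationIdeal_smul_ne_self h (W.map (rightOperatorHom S)) ?_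
  rw [← Submodule.map_smul'', hn]

end LocalNilpotency

/-! ### The derivation given by a primitive element -/

section PrimitiveCommutator

variable {K : Type u} [Field K] {E : Type v} [Ring E] [HopfAlgebra K E] {x : E}

theorem counit_primitive (hx : x ∈ primitives K E) : Coalgebra.counit (R := K) x = 0 := by
  have hx' : Coalgebra.comul (R := K) x = x ⊗ₜ[K] (1 : E) + (1 : E) ⊗ₜ[K] x := hx
  have h := congrArg (Coalgebra.counit (R := K) ∘ₗ (TensorProduct.lid K E).toLinearMap)
    (Coalgebra.rTensor_counit_comul (R := K) x)
  rw [hx'] at h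
  simpa using h

theorem comul_primitive_mul (hx : x ∈ primitives K E) (e : E) :
    Coalgebra.comul (R := K) (x * e) = (LinearMap.mulLeft K x).rTensor E (Coalgebra.comul e) +
      (LinearMap.mulLeft K x).lTensor E (Coalgebra.comul e) := by
  have hx' : Coalgebra.comul (R := K) x = x ⊗ₜ[K] (1 : E) + (1 : E) ⊗ₜ[K] x := hx
  rw [Bialgebra.comul_mul, hx']
  generalize Coalgebra.comul (R := K) e = t
  induction t with
  | zero => simp
  | add y z hy hz => simp only [mul_add, map_add, hy, hz]; abel
  | tmul y z => simp [add_mul]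

/-- In `Δ(xe)` the summand where x acts on the second factor commutes with `T ⊗ 1`, so it cancels.
-/
theorem commutator_mem_leftOperators (hx : x ∈ primitives K E) (T : leftOperators K E) :
    T.1 * LinearMap.mulLeft K x - LinearMap.mulLeft K x * T.1 ∈ leftOperators K E := by
  intro e
  simp only [LinearMap.sub_apply, Module.End.mul_apply, LinearMap.mulLeft_apply, map_sub,
    comul_leftOperator, comul_primitive_mul hx, map_add]
  generalize Coalgebra.comul (R := K) e = t
  induction t with
  | zero => simp
  | add y z hy hz =>
    simp only [map_add] at hy hz ⊢
    rw [← hy, ← hz]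
    abel
  | tmul y z => simp

/-- The derivation `T ↦ [T, x]` of the algebra of left operators. -/
def commutator (hx : x ∈ primitives K E) : leftOperators K E →ₗ[K] leftOperators K E where
  toFun T := ⟨_, commutator_mem_leftOperators hx T⟩
  map_add' S T := Subtype.ext (by simp [add_mul, mul_add]; abel)
  map_smul' r T := Subtype.ext (by simp [smul_sub])

variable (hx : x ∈ primitives K E)

theorem commutator_apply (T : leftOperators K E) (e : E) :
    (commutator hx T).1 e = T.1 (x * e) - x * T.1 e := rfl

theorem commutator_mul (S T : leftOperators K E) :
    commutator hx (S * T) = S * commutator hx T + commutator hx S * T := by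
  refine Subtype.ext (LinearMap.ext fun e ↦ ?_)
  change S.1 (T.1 (x * e)) - x * S.1 (T.1 e) =
    S.1 (T.1 (x * e) - x * T.1 e) + (S.1 (x * T.1 e) - x * S.1 (T.1 e))
  rw [map_sub]
  abel

theorem commutator_mem_pow {n : ℕ} {T : leftOperators K E}
    (hT : T ∈ augmentationIdeal K E ^ (n + 1)) :
    commutator hx T ∈ augmentationIdeal K E ^ n := by
  induction n generalizing T with
  | zero => rw [Submodule.pow_zero, Ideal.one_eq_top]; trivial
  | succ n ih =>
    rw [Ideal.IsTwoSided.pow_succ] at hT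
    induction hT using Submodule.smul_induction_on' with
    | smul S hS T hT =>
      rw [smul_eq_mul, commutator_mul]
      refine add_mem ?_ (Ideal.mul_mem_left _ _ hT)
      rw [Ideal.IsTwoSided.pow_succ]
      exact Ideal.mul_mem_mul hS (ih hT)
    | add S _ T _ hS hT => rw [map_add]; exact add_mem hS hT

theorem commutator_pow {g : leftOperators K E} (hg : g ∈ augmentationIdeal K E)
    (hg1 : commutator hx g - 1 ∈ augmentationIdeal K E) (n : ℕ) :
    commutator hx (g ^ (n + 1)) - (n + 1 : K) • g ^ n ∈ augmentationIdeal K E ^ (n + 1) := by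
  induction n with
  | zero => simpa [Submodule.pow_one] using hg1
  | succ n ih =>
    have h : commutator hx (g ^ (n + 1 + 1)) - ((n + 1 : ℕ) + 1 : K) • g ^ (n + 1) =
        g * (commutator hx (g ^ (n + 1)) - (n + 1 : K) • g ^ n) +
          (commutator hx g - 1) * g ^ (n + 1) := by
      rw [pow_succ' g (n + 1), commutator_mul, mul_sub, sub_mul, mul_smul_comm, ← pow_succ',
        one_mul, add_smul (((n + 1 : ℕ) : K)), one_smul]
      push_cast
      abel
    rw [h, Ideal.IsTwoSided.pow_succ]
    exact add_mem (Ideal.mul_mem_mul hg ih) (Ideal.mul_mem_mul hg1 (Ideal.pow_mem_pow hg _))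

/-- Integration by parts: `D(h gʲ⁺¹) = h D(gʲ⁺¹) + D(h) gʲ⁺¹`, where `D(gʲ⁺¹)` is `(j+1) gʲ` up to
higher order. Passing from h to `D h` trades one order of h for one power of g until h has order 0.
The case j = 0 gives `Iⁱ ⊆ range D + Iⁱ⁺¹`. -/
theorem mul_pow_mem_range_commutator_sup [CharZero K] {g : leftOperators K E}
    (hg : g ∈ augmentationIdeal K E) (hg1 : commutator hx g - 1 ∈ augmentationIdeal K E)
    (i j : ℕ) {h : leftOperators K E} (hh : h ∈ augmentationIdeal K E ^ i) :
    h * g ^ j ∈ LinearMap.range (commutator hx) ⊔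
      (augmentationIdeal K E ^ (i + j + 1)).restrictScalars K := by
  have hder : ∀ (i j : ℕ) (h : leftOperators K E), h ∈ augmentationIdeal K E ^ i →
      commutator hx h * g ^ (j + 1) ∈ LinearMap.range (commutator hx) ⊔
        (augmentationIdeal K E ^ (i + j + 1)).restrictScalars K →
      h * g ^ j ∈ LinearMap.range (commutator hx) ⊔
        (augmentationIdeal K E ^ (i + j + 1)).restrictScalars K := by
    intro i j h hh hX
    have hn : (j + 1 : K) ≠ 0 := by exact_mod_cast j.succ_ne_zero
    have heq : h * g ^ j = (j + 1 : K)⁻¹ • (commutator hx (h * g ^ (j + 1)) -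
        commutator hx h * g ^ (j + 1) -
        h * (commutator hx (g ^ (j + 1)) - (j + 1 : K) • g ^ j)) := by
      rw [commutator_mul, mul_sub, mul_smul_comm, eq_inv_smul_iff₀ hn]
      abel
    rw [heq]
    refine Submodule.smul_mem _ _ (sub_mem (sub_mem ?_ hX) ?_)
    · exact Submodule.mem_sup_left ⟨_, rfl⟩
    · refine Submodule.mem_sup_right ?_
      rw [Submodule.restrictScalars_mem, add_assoc, Ideal.IsTwoSided.pow_add]
      exact Ideal.mul_mem_mul hh (commutator_pow hx hg hg1 j)
  induction i generalizing h j with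
  | zero =>
    refine hder 0 j h hh (Submodule.mem_sup_right ?_)
    rw [Submodule.restrictScalars_mem, zero_add]
    exact Ideal.mul_mem_left _ _ (Ideal.pow_mem_pow hg _)
  | succ i ih =>
    refine hder (i + 1) j h hh ?_
    have := ih (j + 1) (commutator_mem_pow hx hh)
    rwa [show i + (j + 1) + 1 = i + 1 + j + 1 by ring] at this

/-- A functional with value 0 at 1 and value 1 at x gives a first approximation to d/dx. -/
theorem exists_commutator_sub_one_mem (hx0 : x ≠ 0) :
    ∃ g ∈ augmentationIdeal K E, commutator hx g - 1 ∈ augmentationIdeal K E := by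
  have hnot : x ∉ K ∙ (1 : E) := by
    intro h
    obtain ⟨r, rfl⟩ := Submodule.mem_span_singleton.1 h
    have := counit_primitive hx
    rw [map_smul, counit_one_eq, smul_eq_mul, mul_one] at this
    exact hx0 (by rw [this, zero_smul])
  obtain ⟨γ, hγ, h1⟩ := Submodule.exists_le_ker_of_notMem hnot
  have hγ1 : γ 1 = 0 := h1 (Submodule.mem_span_singleton_self 1)
  refine ⟨leftOperator ((γ x)⁻¹ • γ), ?_, ?_⟩
  · rw [mem_augmentationIdeal, leftOperator_one]
    simp [hγ1]
  · rw [mem_augmentationIdeal]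
    have hx' : Coalgebra.comul (R := K) x = x ⊗ₜ[K] (1 : E) + (1 : E) ⊗ₜ[K] x := hx
    have : (commutator hx (leftOperator ((γ x)⁻¹ • γ))).1 1 = 1 := by
      rw [commutator_apply, leftOperator_one, mul_one, leftOperator_apply, hx']
      simp [hγ1, hγ]
    simp [this]

theorem mulLeft_primitive_injective [CharZero K] (hconn : IsConnected K E)
    (hx : x ∈ primitives K E) (hx0 : x ≠ 0) :
    Function.Injective (LinearMap.mulLeft K x) := by
  rw [← LinearMap.ker_eq_bot, LinearMap.ker_eq_bot']
  intro e he
  rw [LinearMap.mulLeft_apply] at he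
  by_contra he0
  classical
  -- Take n + 1 to be the least exponent with `Iⁿ⁺¹ e = 0`, and T in `Iⁿ` with `T e ≠ 0`.
  have hex := exists_augmentationIdeal_pow_apply_eq_zero hconn e
  obtain ⟨n, hn⟩ : ∃ n, Nat.find hex = n + 1 := by
    refine Nat.exists_eq_succ_of_ne_zero fun h0 ↦ he0 ?_
    have := Nat.find_spec hex 1
    rw [h0] at this
    exact this (by rw [Submodule.pow_zero, Ideal.one_eq_top]; trivial)
  have hzero := Nat.find_spec hex
  rw [hn] at hzero
  have hnz := Nat.find_min hex (m := n) (by omega)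
  push Not at hnz
  obtain ⟨T, hT, hTe⟩ := hnz
  obtain ⟨f, hf⟩ : ∃ f : Module.Dual K E, f (T.1 e) ≠ 0 := by
    by_contra! hall
    exact hTe ((Module.forall_dual_apply_eq_zero_iff K _).1 hall)
  obtain ⟨g, hg, hg1⟩ := exists_commutator_sub_one_mem hx hx0
  -- Write `L_f T = D p + r` with r in `Iⁿ⁺¹`. Then `r e = 0` and `ε((D p) e) = ε(p(xe)) - ε(x · p
  -- e) = 0`, contradicting `f(T e) ≠ 0`.
  have hmem := mul_pow_mem_range_commutator_sup hx hg hg1 n 0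
    (Ideal.mul_mem_left _ (leftOperator f) hT)
  rw [pow_zero, mul_one, add_zero] at hmem
  obtain ⟨_, ⟨p, rfl⟩, r, hr, hsum⟩ := Submodule.mem_sup.1 hmem
  refine hf ?_
  rw [← counit_leftOperator]
  have := congrArg (fun S : leftOperators K E ↦ Coalgebra.counit (R := K) (S.1 e)) hsum
  change Coalgebra.counit (R := K) ((commutator hx p).1 e + r.1 e) =
    Coalgebra.counit (R := K) ((leftOperator f).1 (T.1 e)) at this
  rw [← this, commutator_apply, he, hzero r hr, map_zero, add_zero, zero_sub, map_neg,
    Bialgebra.counit_mul, counit_primitive hx, zero_mul, neg_zero]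

theorem exists_commutator_eq_one [CharZero K] (hconn : IsConnected K E) (hx0 : x ≠ 0) :
    ∃ T ∈ augmentationIdeal K E, commutator hx T = 1 := by
  obtain ⟨q, hq⟩ := (LinearMap.mulLeft K x).exists_leftInverse_of_injective
    (LinearMap.ker_eq_bot.2 (mulLeft_primitive_injective hconn hx hx0))
  have hq' : ∀ e, q (x * e) = e := fun e ↦ LinearMap.congr_fun hq e
  let f₀ : Module.Dual K E := Coalgebra.counit ∘ₗ q
  -- The correction forces `f 1 = 0` without changing f on xE, where ε vanishes.
  let f : Module.Dual K E := f₀ - f₀ 1 • Coalgebra.counit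
  have hf : ∀ e, f (x * e) = Coalgebra.counit (R := K) e := fun e ↦ by
    simp [f, f₀, hq', counit_primitive hx]
  refine ⟨leftOperator f, ?_, ?_⟩
  · rw [mem_augmentationIdeal, leftOperator_one]
    simp [f]
  · rw [← leftOperator_counit_comp (commutator hx (leftOperator f)), ← leftOperator_counit_comp 1]
    congr 1
    ext e
    simp only [LinearMap.comp_apply]
    rw [commutator_apply, map_sub, counit_leftOperator, hf, Bialgebra.counit_mul,
      counit_primitive hx]
    simp

end PrimitiveCommutator

/-! ### Taylor coefficients and the weak projection -/

section TaylorCoefficients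

variable {K : Type u} [Field K] {E : Type v} [Ring E] [HopfAlgebra K E] {x : E}

/-- The Taylor coefficients `ε(Tⁿ e)` of `e` along a locally nilpotent operator `T`. -/
noncomputable def taylor (T : leftOperators K E) (hnil : ∀ e, ∃ N, (T ^ N).1 e = 0) :
    E →ₗ[K] ℕ →₀ K where
  toFun e := Finsupp.ofSupportFinite (fun n ↦ Coalgebra.counit (R := K) ((T ^ n).1 e)) (by
    obtain ⟨N, hN⟩ := hnil e
    refine (Set.finite_lt_nat N).subset fun n hn ↦ ?_
    by_contra hle
    obtain ⟨k, rfl⟩ := Nat.exists_eq_add_of_le' (not_lt.1 hle)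
    refine hn ?_
    have : (T ^ (k + N)).1 e = (T ^ k).1 ((T ^ N).1 e) := by rw [pow_add]; rfl
    simp only [this, hN, map_zero])
  map_add' a b := Finsupp.ext fun n ↦ by simp [Finsupp.ofSupportFinite_coe]
  map_smul' r a := Finsupp.ext fun n ↦ by simp [Finsupp.ofSupportFinite_coe]

theorem taylor_apply (T : leftOperators K E) (hnil : ∀ e, ∃ N, (T ^ N).1 e = 0) (e : E) (n : ℕ) :
    taylor T hnil e n = Coalgebra.counit (R := K) ((T ^ n).1 e) := rfl

/-- Contracting the first leg of `Δ e` with `ε ∘ Tⁿ` yields `Tⁿ e`. Hence the coefficients of `Δ e`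
depend only on those of e, which makes the projection a coalgebra map. -/
theorem finsuppTensorFinsupp'_map_taylor_comul (T : leftOperators K E)
    (hnil : ∀ e, ∃ N, (T ^ N).1 e = 0) (e : E) (n m : ℕ) :
    finsuppTensorFinsupp' K ℕ ℕ
      (TensorProduct.map (taylor T hnil) (taylor T hnil) (Coalgebra.comul e)) (n, m) =
      taylor T hnil e (m + n) := by
  have key : ∀ t : E ⊗[K] E, finsuppTensorFinsupp' K ℕ ℕ
      (TensorProduct.map (taylor T hnil) (taylor T hnil) t) (n, m) =
      Coalgebra.counit (R := K) ((T ^ m).1 (TensorProduct.lid K E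
        ((Coalgebra.counit ∘ₗ (T ^ n).1).rTensor E t))) := by
    intro t
    induction t with
    | zero => simp
    | add y z hy hz => simp only [map_add, Finsupp.add_apply, hy, hz]
    | tmul y z =>
      rw [TensorProduct.map_tmul, finsuppTensorFinsupp'_apply_apply, taylor_apply, taylor_apply]
      simp
  rw [key, ← leftOperator_apply, leftOperator_counit_comp, taylor_apply, pow_add]
  rfl

variable (K x) in
/-- The divided power `xⁿ / n!`. -/
noncomputable def dividedPower (n : ℕ) : E := (n.factorial : K)⁻¹ • x ^ n

@[simp] theorem dividedPower_zero : dividedPower K x 0 = 1 := by simp [dividedPower]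

theorem mul_dividedPower [CharZero K] (n : ℕ) :
    x * dividedPower K x n = (n + 1 : K) • dividedPower K x (n + 1) := by
  have h1 : (n + 1 : K) ≠ 0 := by exact_mod_cast n.succ_ne_zero
  rw [dividedPower, dividedPower, smul_smul, mul_smul_comm, ← pow_succ', Nat.factorial_succ]
  push_cast
  rw [mul_inv, mul_inv_cancel_left₀ h1]

theorem dividedPower_mem_adjoin (n : ℕ) : dividedPower K x n ∈ Algebra.adjoin K {x} :=
  (Algebra.adjoin K {x}).smul_mem (pow_mem (Algebra.self_mem_adjoin_singleton K x) n) _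

section

variable {hx : x ∈ primitives K E} {T : leftOperators K E}

theorem apply_mul_of_commutator_eq_one (hT : commutator hx T = 1) (e : E) :
    T.1 (x * e) = x * T.1 e + e := by
  have h := commutator_apply hx T e
  rw [hT] at h
  rw [add_comm, ← sub_eq_iff_eq_add]
  exact h.symm

theorem apply_dividedPower_mul [CharZero K] (hT : commutator hx T = 1) {w : E} (hw : T.1 w = 0)
    (n : ℕ) : T.1 (dividedPower K x (n + 1) * w) = dividedPower K x n * w := by
  have key : ∀ n : ℕ, (n + 1 : K) • T.1 (dividedPower K x (n + 1) * w) =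
      x * T.1 (dividedPower K x n * w) + dividedPower K x n * w := by
    intro n
    rw [← map_smul, ← smul_mul_assoc, ← mul_dividedPower, mul_assoc,
      apply_mul_of_commutator_eq_one hT]
  have hn : ∀ n : ℕ, (n + 1 : K) ≠ 0 := fun n ↦ by exact_mod_cast n.succ_ne_zero
  induction n with
  | zero =>
    have := key 0
    rw [dividedPower_zero, one_mul, hw] at this
    simpa using this
  | succ n ih =>
    apply smul_right_injective E (hn (n + 1))
    have := key (n + 1)
    rw [ih, ← mul_assoc, mul_dividedPower, smul_mul_assoc] at this
    simp only
    rw [this]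
    push_cast
    module

theorem pow_apply_dividedPower_mul [CharZero K] (hT : commutator hx T = 1) {w : E}
    (hw : T.1 w = 0) (m n : ℕ) : (T ^ m).1 (dividedPower K x n * w) =
      if m ≤ n then dividedPower K x (n - m) * w else 0 := by
  induction m generalizing n with
  | zero => simp
  | succ m ih =>
    have h : (T ^ (m + 1)).1 (dividedPower K x n * w) =
      (T ^ m).1 (T.1 (dividedPower K x n * w)) := by rw [pow_succ]; rfl
    rw [h]
    cases n with
    | zero => simp [hw]
    | succ n => rw [apply_dividedPower_mul hT hw, ih]; simp

theorem pow_apply_mul (hT : commutator hx T = 1) (n : ℕ) (e : E) :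
    (T ^ (n + 1)).1 (x * e) = x * (T ^ (n + 1)).1 e + (n + 1 : K) • (T ^ n).1 e := by
  induction n with
  | zero => simpa using apply_mul_of_commutator_eq_one hT e
  | succ n ih =>
    have h (k : ℕ) (y : E) : (T ^ (k + 1)).1 y = T.1 ((T ^ k).1 y) := by rw [pow_succ']; rfl
    rw [h (n + 1) (x * e), ih, map_add, apply_mul_of_commutator_eq_one hT, ← h (n + 1), map_smul,
      ← h n]
    push_cast
    module

theorem counit_dividedPower (hx : x ∈ primitives K E) (n : ℕ) :
    Coalgebra.counit (R := K) (dividedPower K x n) = if n = 0 then 1 else 0 := by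
  cases n with
  | zero => simp
  | succ n =>
    rw [dividedPower, map_smul, pow_succ', Bialgebra.counit_mul, counit_primitive hx]
    simp

variable (K x) in
/-- The linear map from finitely supported sequences to `E` sending `δₙ` to `xⁿ / n!`. -/
noncomputable def exponentialSeries : (ℕ →₀ K) →ₗ[K] E :=
  Finsupp.linearCombination K (dividedPower K x)

theorem exponentialSeries_mem (v : ℕ →₀ K) : exponentialSeries K x v ∈ Algebra.adjoin K {x} := by
  rw [exponentialSeries, Finsupp.linearCombination_apply]
  exact Subalgebra.sum_mem _ fun n _ ↦ Subalgebra.smul_mem _ (dividedPower_mem_adjoin n) _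

variable (hnil : ∀ e, ∃ N, (T ^ N).1 e = 0)

theorem taylor_exponentialSeries [CharZero K] (hT : commutator hx T = 1)
    (hT1 : T ∈ augmentationIdeal K E) (v : ℕ →₀ K) :
    taylor T hnil (exponentialSeries K x v) = v := by
  suffices h : taylor T hnil ∘ₗ exponentialSeries K x = LinearMap.id from LinearMap.congr_fun h v
  ext n m
  have := pow_apply_dividedPower_mul hT (mem_augmentationIdeal.1 hT1) m n
  rw [mul_one, mul_one] at this
  simp only [LinearMap.comp_apply, Finsupp.lsingle_apply, LinearMap.id_apply, exponentialSeries,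
    Finsupp.linearCombination_single, one_smul, taylor_apply, this]
  split_ifs with hmn
  · rw [counit_dividedPower hx, Finsupp.single_apply]
    congr 1
    exact propext (by omega)
  · rw [map_zero, Finsupp.single_apply, if_neg (by omega)]

theorem exponentialSeries_taylor [CharZero K] (hT : commutator hx T = 1)
    (hT1 : T ∈ augmentationIdeal K E) {e : E} (he : e ∈ Algebra.adjoin K {x}) :
    exponentialSeries K x (taylor T hnil e) = e := by
  obtain ⟨v, rfl⟩ : ∃ v, exponentialSeries K x v = e := by
    rw [Algebra.adjoin_singleton_eq_range_aeval] at he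
    obtain ⟨p, rfl⟩ := he
    change Polynomial.aeval x p ∈ LinearMap.range (exponentialSeries K x)
    rw [Polynomial.aeval_eq_sum_range]
    refine Submodule.sum_mem _ fun n _ ↦ Submodule.smul_mem _ _ ⟨Finsupp.single n n.factorial, ?_⟩
    have : (n.factorial : K) ≠ 0 := by exact_mod_cast n.factorial_ne_zero
    rw [exponentialSeries, Finsupp.linearCombination_single, dividedPower, smul_smul,
      mul_inv_cancel₀ this, one_smul]
  rw [taylor_exponentialSeries hnil hT hT1]

/-- Since `ε(x) = 0`, the Leibniz rule gives `ε(Tⁿ⁺¹(xe)) = (n+1) ε(Tⁿ e)`: multiplication by x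
shifts and rescales coefficients. -/
theorem taylor_adjoin_mul_eq_zero (hT : commutator hx T = 1) {h : E}
    (hh : h ∈ Algebra.adjoin K {x}) {e : E} (he : taylor T hnil e = 0) :
    taylor T hnil (h * e) = 0 := by
  induction hh using Algebra.adjoin_induction generalizing e with
  | mem y hy =>
    rw [Set.mem_singleton_iff] at hy
    subst hy
    have he' : ∀ n, Coalgebra.counit (R := K) ((T ^ n).1 e) = 0 := fun n ↦ by
      rw [← taylor_apply T hnil, he]; rfl
    ext n
    rw [taylor_apply]
    cases n with
    | zero => simp [counit_primitive hx]
    | succ n =>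
      rw [pow_apply_mul hT, map_add, Bialgebra.counit_mul, counit_primitive hx, map_smul, he' n,
        zero_mul, smul_zero, add_zero]
      rfl
  | algebraMap r => rw [← Algebra.smul_def, map_smul, he, smul_zero]
  | add y z _ _ hy hz => rw [add_mul, map_add, hy he, hz he, add_zero]
  | mul y z _ _ hy hz => rw [mul_assoc]; exact hy (hz he)

/-- The Taylor coefficients of the elements of `K[x]`. -/
noncomputable def taylorAdjoin [CharZero K] (hT : commutator hx T = 1)
    (hT1 : T ∈ augmentationIdeal K E) :
    (adjoinPrimitive x hx).toSubalgebra ≃ₗ[K] ℕ →₀ K where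
  __ := taylor T hnil ∘ₗ (adjoinPrimitive x hx).incl
  invFun v := ⟨exponentialSeries K x v, exponentialSeries_mem v⟩
  left_inv h := Subtype.ext (exponentialSeries_taylor hnil hT hT1 h.2)
  right_inv v := taylor_exponentialSeries hnil hT hT1 v

/-- The weak projection `e ↦ ∑ ε(Tⁿ e) xⁿ / n!` of `E` onto `K[x]`. -/
noncomputable def taylorWeakProjection [CharZero K] (hT : commutator hx T = 1)
    (hT1 : T ∈ augmentationIdeal K E) :
    WeakProjection (adjoinPrimitive x hx) :=
  let φ := taylorAdjoin hnil hT hT1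
  let π : E →ₗ[K] (adjoinPrimitive x hx).toSubalgebra := φ.symm.toLinearMap ∘ₗ taylor T hnil
  have hπ : ∀ e, taylor T hnil (π e : E) = taylor T hnil e := fun e ↦
    φ.apply_symm_apply (taylor T hnil e)
  { π with
    counit_comp := by
      ext e
      have := DFunLike.congr_fun (hπ e) 0
      rw [taylor_apply, taylor_apply, pow_zero] at this
      exact this
    map_comp_comul := by
      ext e
      -- Both sides are compared through Taylor coefficients in each leg, on which e and `π e`
      -- agree.
      have hinj : Function.Injective (TensorProduct.map φ.toLinearMap φ.toLinearMap) :=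
        TensorProduct.map_injective_of_flat_flat _ _ φ.injective φ.injective
      apply hinj
      apply (finsuppTensorFinsupp' K ℕ ℕ).injective
      have h1 : TensorProduct.map φ.toLinearMap φ.toLinearMap
          (TensorProduct.map π π (Coalgebra.comul e)) =
          TensorProduct.map (taylor T hnil) (taylor T hnil) (Coalgebra.comul e) := by
        rw [← LinearMap.comp_apply, ← TensorProduct.map_comp]
        congr 2 <;> exact LinearMap.ext hπ
      have h2 : TensorProduct.map φ.toLinearMap φ.toLinearMap (Coalgebra.comul (π e)) =
          TensorProduct.map (taylor T hnil) (taylor T hnil) (Coalgebra.comul (π e : E)) := by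
        rw [← HopfSubalgebra.map_comulAux,
          ← LinearMap.comp_apply (TensorProduct.map _ _) (TensorProduct.map _ _), ← TensorProduct.map_comp]
        rfl
      refine Eq.trans (congrArg _ h1) (Eq.trans ?_ (congrArg _ h2).symm)
      ext ⟨n, m⟩
      rw [finsuppTensorFinsupp'_map_taylor_comul, finsuppTensorFinsupp'_map_taylor_comul, hπ]
    map_mul_left := by
      intro h e
      apply φ.injective
      change taylor T hnil (π (h * e) : E) = taylor T hnil (h * (π e : E))
      -- The difference `e - π e` has no Taylor coefficients, and neither do its multiples by K[x].
      rw [hπ, ← sub_eq_zero, ← map_sub, ← mul_sub]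
      exact taylor_adjoin_mul_eq_zero hnil hT h.2 (by rw [map_sub, hπ, sub_self])
    map_coe := fun h ↦ φ.injective (hπ h) }

end

end TaylorCoefficients

/-! ### Freeness over K[x] and the complement of xE -/

section Decomposition

variable {K : Type u} [Field K] {E : Type v} [Ring E] [HopfAlgebra K E] {x : E}
  {hx : x ∈ primitives K E} {T : leftOperators K E}

variable (x T) in
/-- The map `(wₙ) ↦ ∑ xⁿ / n! · wₙ` on finitely supported sequences in the kernel of `T`. -/
noncomputable def kernelSeries : (ℕ →₀ LinearMap.ker T.1) →ₗ[K] E :=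
  Finsupp.lsum K fun n ↦ LinearMap.mulLeft K (dividedPower K x n) ∘ₗ (LinearMap.ker T.1).subtype

theorem kernelSeries_single (n : ℕ) (w : LinearMap.ker T.1) :
    kernelSeries x T (Finsupp.single n w) = dividedPower K x n * w := by
  simp [kernelSeries]

theorem kernelSeries_injective [CharZero K] (hT : commutator hx T = 1) :
    Function.Injective (kernelSeries x T) := by
  refine (injective_iff_map_eq_zero _).2 fun v hv ↦ ?_
  by_contra hv0
  have hne := Finsupp.support_nonempty_iff.2 hv0
  -- Applying `Tᴺ` at the top index N kills all lower terms and leaves the coefficient `v N`.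
  set N := v.support.max' hne
  have hN : N ∈ v.support := v.support.max'_mem hne
  refine Finsupp.mem_support_iff.1 hN (Subtype.ext ?_)
  have h := congrArg (T ^ N).1 hv
  rw [map_zero, kernelSeries, Finsupp.lsum_apply, Finsupp.sum, map_sum,
    Finset.sum_eq_single_of_mem N hN] at h
  · rw [LinearMap.comp_apply, LinearMap.mulLeft_apply, Submodule.subtype_apply,
      pow_apply_dividedPower_mul hT (v N).2] at h
    simpa using h
  · intro n hn hnN
    have : n ≤ N := v.support.le_max' n hn
    rw [LinearMap.comp_apply, LinearMap.mulLeft_apply, Submodule.subtype_apply,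
      pow_apply_dividedPower_mul hT (v n).2, if_neg (by omega)]

theorem kernelSeries_surjective [CharZero K] (hT : commutator hx T = 1)
    (hnil : ∀ e, ∃ N, (T ^ N).1 e = 0) :
    Function.Surjective (kernelSeries x T) := by
  intro e
  obtain ⟨N, hN⟩ := hnil e
  change e ∈ LinearMap.range (kernelSeries x T)
  induction N generalizing e with
  | zero =>
    have : e = 0 := hN
    rw [this]
    exact zero_mem _
  | succ N ih =>
    obtain ⟨v, hv⟩ := ih (T.1 e) (by rw [← hN, pow_succ]; rfl)
    have hshift : T.1 ∘ₗ kernelSeries x T ∘ₗ Finsupp.lmapDomain _ K Nat.succ =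
        kernelSeries x T := by
      refine Finsupp.lhom_ext fun n w ↦ ?_
      rw [LinearMap.comp_apply, LinearMap.comp_apply, Finsupp.lmapDomain_apply,
        Finsupp.mapDomain_single, kernelSeries_single, kernelSeries_single]
      exact apply_dividedPower_mul hT w.2 n
    -- An antiderivative of `T e`, obtained by shifting its expansion by one; `e - e'` is the
    -- constant term.
    set e' := kernelSeries x T (Finsupp.lmapDomain _ K Nat.succ v) with he'
    have hker : e - e' ∈ LinearMap.ker T.1 := by
      rw [LinearMap.mem_ker, map_sub, sub_eq_zero, ← hv]
      exact (LinearMap.congr_fun hshift v).symm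
    have : kernelSeries x T (Finsupp.single 0 ⟨e - e', hker⟩) = e - e' := by
      rw [kernelSeries_single, dividedPower_zero, one_mul]
    rw [← sub_add_cancel e e', ← this]
    exact add_mem ⟨_, rfl⟩ ⟨_, rfl⟩

theorem isCompl_rightIdeal_ker [CharZero K] (hT : commutator hx T = 1)
    (hnil : ∀ e, ∃ N, (T ^ N).1 e = 0) :
    IsCompl (rightIdeal K x) (LinearMap.ker T.1) := by
  refine ⟨Submodule.disjoint_def.2 ?_, codisjoint_iff.2 (eq_top_iff.2 fun e _ ↦ ?_)⟩
  · rintro _ ⟨e, rfl⟩ he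
    rw [LinearMap.mulLeft_apply, LinearMap.mem_ker] at he
    rw [LinearMap.mulLeft_apply]
    -- If `T(xe) = 0` and `Tᴺ⁺¹ e = 0`, the Leibniz rule leaves `(N+1) Tᴺ e = 0`; in characteristic
    -- 0 this descends to `e = 0`.
    suffices h : ∀ N : ℕ, (T ^ N).1 e = 0 → e = 0 by
      obtain ⟨N, hN⟩ := hnil e
      rw [h N hN, mul_zero]
    intro N hN
    induction N with
    | zero => exact hN
    | succ N ih =>
      refine ih ?_
      have h := pow_apply_mul hT N e
      have h0 : (T ^ (N + 1)).1 (x * e) = (T ^ N).1 (T.1 (x * e)) := by rw [pow_succ]; rfl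
      rw [h0, he, map_zero, hN, mul_zero, zero_add, eq_comm, smul_eq_zero] at h
      exact h.resolve_left (by exact_mod_cast N.succ_ne_zero)
  · obtain ⟨v, rfl⟩ := kernelSeries_surjective hT hnil e
    induction v using Finsupp.induction_linear with
    | zero => rw [map_zero]; exact zero_mem _
    | add v w hv hw => rw [map_add]; exact add_mem (hv trivial) (hw trivial)
    | single n w =>
      rw [kernelSeries_single]
      cases n with
      | zero =>
        rw [dividedPower_zero, one_mul]
        exact Submodule.mem_sup_right w.2
      | succ n =>
        refine Submodule.mem_sup_left ⟨(((n + 1).factorial : K)⁻¹ • x ^ n) * w, ?_⟩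
        rw [LinearMap.mulLeft_apply, dividedPower, smul_mul_assoc, smul_mul_assoc, mul_smul_comm,
          ← mul_assoc, ← pow_succ']

/-- The decomposition `E ≃ K[x] ⊗ E / xE`. -/
noncomputable def decomposition [CharZero K] (hT : commutator hx T = 1) (hT1 : T ∈ augmentationIdeal K E)
    (hnil : ∀ e, ∃ N, (T ^ N).1 e = 0) :
    E ≃ₗ[K] (adjoinPrimitive x hx).toSubalgebra ⊗[K] (E ⧸ rightIdeal K x) :=
  (LinearEquiv.ofBijective (kernelSeries x T)
    ⟨kernelSeries_injective hT, kernelSeries_surjective hT hnil⟩).symm ≪≫ₗ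
  (TensorProduct.finsuppScalarLeft K (LinearMap.ker T.1) ℕ).symm ≪≫ₗ
  TensorProduct.congr (taylorAdjoin hnil hT hT1).symm
    (Submodule.quotientEquivOfIsCompl _ _ (isCompl_rightIdeal_ker hT hnil)).symm

end Decomposition
end ConnectedHopf

theorem mainTheorem10 {K : Type*} [Field K] [CharZero K] {E : Type*} [Ring E] [HopfAlgebra K E]
    (hconn : ConnectedHopf.IsConnected K E)
    (hE : (⊥ : Subalgebra K E) ≠ ⊤)
    (x : E) (hx : x ∈ ConnectedHopf.primitives K E) (hx0 : x ≠ 0) :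
    Nonempty (ConnectedHopf.WeakProjection (ConnectedHopf.adjoinPrimitive x hx)) ∧
    Nonempty (E ≃ₗ[K]
      (ConnectedHopf.adjoinPrimitive x hx).toSubalgebra ⊗[K]
        (E ⧸ ConnectedHopf.rightIdeal K x)) := by
  obtain ⟨T, hT1, hT⟩ := ConnectedHopf.exists_commutator_eq_one hx hconn hx0
  have hnil : ∀ e, ∃ N, (T ^ N).1 e = 0 := fun e ↦ by
    obtain ⟨N, hN⟩ := ConnectedHopf.exists_augmentationIdeal_pow_apply_eq_zero hconn e
    exact ⟨N, hN _ (Ideal.pow_mem_pow hT1 N)⟩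
  exact ⟨⟨ConnectedHopf.taylorWeakProjection hnil hT hT1⟩,
    ⟨ConnectedHopf.decomposition hT hT1 hnil⟩⟩
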